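/- Let $V$ be a finite set and $\mathcal L=\{x\in[0,\infty)^V:\|x\|_\infty>1\}$. Let $\boldsymbol Y=(Y_i)_{i\in V}$ be a random vector having a multivariate Pareto distribution with normalized margins, that is, $\boldsymbol Y\in\mathcal L$ almost surely, $\mathbb P(\boldsymbol Y\in tA)=t^{-1}\,\mathbb P(\boldsymbol Y\in A)$ for all $t\ge 1$ and all Borel sets $A\subset\mathcal L$, and the probability $\mathbb P(Y_i>1)$ is the same for all $i\in V$ (hence it is positive). For $m\in V$ let $\boldsymbol Y^m$ denote $\boldsymbol Y$ conditioned on the event $\{Y_m>1\}$. Let $T=(V,E)$ be a tree, and suppose that $\boldsymbol Y$ is an extremal graphical model on $T$: whenever $A,B,C\subset V$ are pairwise disjoint and every path in $T$ from $A$ to $C$ contains a node of $B$, the vectors $\boldsymbol Y^m_A$ and $\boldsymbol Y^m_C$ are conditionally independent given $\boldsymbol Y^m_B$, for every $m\in V$. Suppose that for every $m\in V$ the extremal variogram rooted at $m$, $$\Gamma^{(m)}_{ij}=\operatorname{Var}\{\log Y^m_i-\log Y^m_j\},\qquad i,j\in V,$$ exists, that is, for all $i,j\in V$ one has $Y^m_i,Y^m_j>0$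 almost surely and $\log Y^m_i-\log Y^m_j$ is square integrable. Suppose moreover that $\mathbb P(Y_i\ne Y_j)>0$ for all $i\neq j$ in $V$. Let $w_m\ge 0$, $m\in V$, with $\max_{m\in V}w_m>0$, and put $\rho_{ij}=\sum_{m\in V}w_m\Gamma^{(m)}_{ij}$. Then the minimum spanning tree with weights $\rho_{ij}$, that is, the minimizer of $\sum_{\{i,j\}\in E'}\rho_{ij}$ over all trees $T'=(V,E')$ with node set $V$, exists, is unique, and equals $T$. -/

import Mathlib

open MeasureTheory ProbabilityTheory
open scoped Pointwise

namespace ExtremalTree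

noncomputable section

/-- The set `𝓛 = {x ≥ 0 : ‖x‖_∞ > 1}` (the norm on `V → ℝ` is the sup norm). -/
def exceedanceSet (V : Type*) [Fintype V] : Set (V → ℝ) :=
  {x | 0 ≤ x ∧ 1 < ‖x‖}

/-- `μ` is a multivariate Pareto distribution with normalized margins: a probability measure
supported on `𝓛`, homogeneous in the sense that `μ (t A) = t⁻¹ μ A` for `t ≥ 1` and Borel `A ⊆ 𝓛`,
whose coordinates all have the same exceedance probability `μ {x | x i > 1}`.  (This common
probability is automatically positive, and equals `1 / ℓ(1, …, 1)` for the associated stable tail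
dependence function `ℓ`, whose normalization `ℓ(eᵢ) = 1` is the last field.) -/
structure IsMultivariatePareto {V : Type*} [Fintype V] (μ : Measure (V → ℝ)) : Prop where
  isProbabilityMeasure : IsProbabilityMeasure μ
  ae_mem : ∀ᵐ x ∂μ, x ∈ exceedanceSet V
  homogeneous : ∀ t : ℝ, 1 ≤ t → ∀ A : Set (V → ℝ), MeasurableSet A → A ⊆ exceedanceSet V →
    μ (t • A) = ENNReal.ofReal t⁻¹ * μ A
  margins : ∀ i j : V, μ {x | 1 < x i} = μ {x | 1 < x j}

/-- The law of `Y^m`, that is, of `Y` conditioned on `Y_m > 1`, where `μ` is the law of `Y`. -/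
def exceedanceLaw {V : Type*} (μ : Measure (V → ℝ)) (m : V) : Measure (V → ℝ) :=
  cond μ {x | 1 < x m}

instance {V : Type*} (μ : Measure (V → ℝ)) (m : V) : IsFiniteMeasure (exceedanceLaw μ m) := by
  unfold exceedanceLaw
  infer_instance

/-- The coordinate projection `x ↦ x_A`. -/
def proj {V : Type*} (A : Set V) (x : V → ℝ) : A → ℝ := fun i => x i

theorem measurable_proj {V : Type*} (A : Set V) : Measurable (proj A) :=
  measurable_pi_lambda _ fun i => measurable_pi_apply (i : V)

/-- Extremal conditional independence `Y_A ⊥_e Y_C | Y_B`: for every `m`, the vectors `Y^m_A` and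
`Y^m_C` are conditionally independent given `Y^m_B`. -/
def ExtremalCondIndep {V : Type*} [Fintype V] (μ : Measure (V → ℝ)) (A C B : Set V) : Prop :=
  ∀ m : V, CondIndepFun (MeasurableSpace.comap (proj B) inferInstance)
    (measurable_proj B).comap_le (proj A) (proj C) (exceedanceLaw μ m)

/-- `B` separates `A` and `C` in `G`: every path from `A` to `C` contains a node of `B`. -/
def Separates {V : Type*} (G : SimpleGraph V) (A C B : Set V) : Prop :=
  ∀ a ∈ A, ∀ c ∈ C, ∀ p : G.Walk a c, p.IsPath → ∃ b ∈ p.support, b ∈ B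

/-- `μ` is (the law of) an extremal graphical model on `G`: a multivariate Pareto distribution with
the global Markov property on `G` for extremal conditional independence. -/
structure IsExtremalGraphicalModel {V : Type*} [Fintype V] (μ : Measure (V → ℝ))
    (G : SimpleGraph V) : Prop where
  isMultivariatePareto : IsMultivariatePareto μ
  globalMarkov : ∀ A B C : Set V, Disjoint A B → Disjoint A C → Disjoint B C →
    Separates G A C B → ExtremalCondIndep μ A C B

/-- The extremal variogram matrix rooted at `m` exists: for all `i, j`, the variable
`log Y^m_i - log Y^m_j` is a.s. well defined and finite (`Y^m_i, Y^m_j > 0` a.s.; recall that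
`Real.log 0 = 0` by convention) and square integrable. -/
def VariogramExists {V : Type*} (μ : Measure (V → ℝ)) (m : V) : Prop :=
  ∀ i j : V, (∀ᵐ x ∂(exceedanceLaw μ m), 0 < x i ∧ 0 < x j) ∧
    MemLp (fun x : V → ℝ => Real.log (x i) - Real.log (x j)) 2 (exceedanceLaw μ m)

/-- The extremal variogram `Γ^{(m)}_{ij} = Var (log Y^m_i - log Y^m_j)`. -/
def variogram {V : Type*} (μ : Measure (V → ℝ)) (m i j : V) : ℝ :=
  variance (fun x : V → ℝ => Real.log (x i) - Real.log (x j)) (exceedanceLaw μ m)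

theorem variogram_comm {V : Type*} (μ : Measure (V → ℝ)) (m i j : V) :
    variogram μ m i j = variogram μ m j i := by
  unfold variogram
  rw [← variance_neg]
  congr 1
  ext x
  simp

/-- The weight `∑ₘ wₘ Γ^{(m)}_{ij}` of the unordered pair `{i, j}`. -/
def weightedVariogram {V : Type*} [Fintype V] (μ : Measure (V → ℝ)) (w : V → ℝ) : Sym2 V → ℝ :=
  Sym2.lift ⟨fun i j => ∑ m, w m * variogram μ m i j, fun i j => by
    simp only [variogram_comm μ _ i j]⟩

open Classical in
/-- The total weight of the edges of `T`, each undirected edge being counted once. -/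
def totalWeight {V : Type*} [Fintype V] (ρ : Sym2 V → ℝ) (T : SimpleGraph V) : ℝ :=
  ∑ e ∈ T.edgeFinset, ρ e

/-- `T` is a minimum spanning tree on the node set `V` for the weights `ρ`: a tree on `V` of
minimal total weight among all trees on `V`. -/
def IsMinimumSpanningTree {V : Type*} [Fintype V] (ρ : Sym2 V → ℝ) (T : SimpleGraph V) : Prop :=
  T.IsTree ∧ ∀ T' : SimpleGraph V, T'.IsTree → totalWeight ρ T ≤ totalWeight ρ T'

end

end ExtremalTree

/-!
For a scale-invariant event `E`, homogeneity gives `P(Y ∈ E, Y_k > t) = t⁻¹ P(Y ∈ E, Y_k > 1)` for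
`t ≥ 1`. Hence under `Y^k` the log-ratios of coordinates are independent of `Y_k`. If `k` separates
`j` from `i` and `m`, then conditional independence given `Y_k` upgrades this to independence of
`log (Y_j / Y_k)` and `(Y_i, Y_k, Y_m)` under `Y^k`. A second use of homogeneity moves the root from
`k` to `m`, so that `log (Y_j / Y_k)` and `log (Y_i / Y_k)` are independent under `Y^m`, and their
variances add. As every node `m` is separated by `k` from `i` or from `j` as soon as `k` separates
`i` from `j`, each variogram is additive along the paths of `T`.

No variogram vanishes at an edge: otherwise `Y_i / Y_j` would be constant almost surely, and the
equality of the margins forces this constant to be `1`. So `ρ` is a tree metric on `T`, and the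
weight of any pair `{u, v}` exceeds that of every other edge on the path of `T` from `u` to `v`. A
spanning tree with an edge `{u, v}` outside `T` can therefore be improved by exchanging that edge.
-/

namespace ExtremalTree

section ConditionalIndependence

open MeasurableSpace

variable {Ω : Type*} {m' m₁ m₂ mΩ : MeasurableSpace Ω} {μ : Measure Ω}

theorem isPiSystem_image2_inter (m₁ m₂ : MeasurableSpace Ω) :
    IsPiSystem (Set.image2 (· ∩ ·) {s | MeasurableSet[m₁] s} {t | MeasurableSet[m₂] t}) := by
  rintro _ ⟨s, hs, t, ht, rfl⟩ _ ⟨s', hs', t', ht', rfl⟩ -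
  exact ⟨s ∩ s', hs.inter hs', t ∩ t', ht.inter ht', Set.inter_inter_inter_comm s s' t t'⟩

theorem generateFrom_image2_inter (m₁ m₂ : MeasurableSpace Ω) :
    generateFrom (Set.image2 (· ∩ ·) {s | MeasurableSet[m₁] s} {t | MeasurableSet[m₂] t}) =
      m₁ ⊔ m₂ := by
  apply le_antisymm
  · refine generateFrom_le ?_
    rintro _ ⟨s, hs, t, ht, rfl⟩
    exact MeasurableSet.inter ((le_sup_left : m₁ ≤ m₁ ⊔ m₂) s hs)
      ((le_sup_right : m₂ ≤ m₁ ⊔ m₂) t ht)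
  · exact sup_le
      (fun s hs => measurableSet_generateFrom ⟨s, hs, Set.univ, .univ, Set.inter_univ s⟩)
      (fun t ht => measurableSet_generateFrom ⟨Set.univ, .univ, t, ht, Set.univ_inter t⟩)

theorem condExp_inter_ae_eq_indicator [IsFiniteMeasure μ] {u s : Set Ω}
    (hu : MeasurableSet[m'] u) (hs : MeasurableSet s) :
    μ⟦u ∩ s | m'⟧ =ᵐ[μ] u.indicator (μ⟦s | m'⟧) := by
  rw [← Set.indicator_indicator]
  exact condExp_indicator ((integrable_const (1 : ℝ)).indicator hs) hu

variable [StandardBorelSpace Ω]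

theorem condIndep_sup_left [IsFiniteMeasure μ] {hm' : m' ≤ mΩ} (hm₁ : m₁ ≤ mΩ) (hm₂ : m₂ ≤ mΩ)
    (h : CondIndep m' m₁ m₂ hm' μ) : CondIndep m' (m' ⊔ m₁) m₂ hm' μ := by
  refine CondIndepSets.condIndep (sup_le hm' hm₁) hm₂ (isPiSystem_image2_inter m' m₁)
    (@isPiSystem_measurableSet Ω m₂) (generateFrom_image2_inter m' m₁).symm
    (@generateFrom_measurableSet Ω m₂).symm ?_
  rw [condIndepSets_iff]
  · rintro _ t ⟨u, hu, s, hs, rfl⟩ ht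
    have hst := (condIndep_iff m' m₁ m₂ hm' hm₁ hm₂ μ).1 h s t hs ht
    have hu_st := condExp_inter_ae_eq_indicator (μ := μ) hu ((hm₁ s hs).inter (hm₂ t ht))
    have hu_s := condExp_inter_ae_eq_indicator (μ := μ) hu (hm₁ s hs)
    simp only [Set.inter_assoc]
    filter_upwards [hst, hu_st, hu_s] with ω h₁ h₂ h₃
    rw [h₂, Pi.mul_apply, h₃]
    by_cases hω : ω ∈ u
    · rw [Set.indicator_of_mem hω, Set.indicator_of_mem hω, h₁, Pi.mul_apply]
    · rw [Set.indicator_of_notMem hω, Set.indicator_of_notMem hω, zero_mul]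
  · rintro _ ⟨u, hu, s, hs, rfl⟩
    exact (hm' u hu).inter (hm₁ s hs)
  · exact fun t ht => hm₂ t ht

theorem indep_sup_of_condIndep [IsProbabilityMeasure μ] {hm' : m' ≤ mΩ} (hm₁ : m₁ ≤ mΩ)
    (hm₂ : m₂ ≤ mΩ) (hind : Indep m₁ m' μ) (hci : CondIndep m' m₁ m₂ hm' μ) :
    Indep m₁ (m' ⊔ m₂) μ := by
  refine IndepSets.indep hm₁ (sup_le hm' hm₂) (@isPiSystem_measurableSet Ω m₁)
    (isPiSystem_image2_inter m' m₂) (@generateFrom_measurableSet Ω m₁).symm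
    (generateFrom_image2_inter m' m₂).symm ?_
  rw [IndepSets_iff]
  rintro s _ hs ⟨u, hu, t, ht, rfl⟩
  have hst : μ⟦s ∩ t | m'⟧ =ᵐ[μ] fun ω => μ.real s * (μ⟦t | m'⟧) ω := by
    have hs_const : μ⟦s | m'⟧ =ᵐ[μ] fun _ => μ.real s := by
      have := condExp_indep_eq hm₁ hm'
        ((stronglyMeasurable_const (b := (1 : ℝ))).indicator hs) hind
      simpa [integral_indicator_const _ (hm₁ s hs)] using this
    filter_upwards [(condIndep_iff m' m₁ m₂ hm' hm₁ hm₂ μ).1 hci s t hs ht, hs_const]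
      with ω h₁ h₂
    rw [h₁, Pi.mul_apply, h₂]
  have setIntegral_eq : ∀ {r : Set Ω}, MeasurableSet r →
      ∫ ω in u, (μ⟦r | m'⟧) ω ∂μ = μ.real (u ∩ r) := fun {r} hr => by
    rw [setIntegral_condExp hm' ((integrable_const _).indicator hr) hu,
      setIntegral_indicator hr, setIntegral_const, smul_eq_mul, mul_one]
  rw [← ENNReal.toReal_eq_toReal_iff' (by finiteness) (by finiteness), ENNReal.toReal_mul]
  change μ.real (s ∩ (u ∩ t)) = μ.real s * μ.real (u ∩ t)
  rw [Set.inter_left_comm, ← setIntegral_eq ((hm₁ s hs).inter (hm₂ t ht)),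
    ← setIntegral_eq (hm₂ t ht), ← integral_const_mul]
  exact setIntegral_congr_ae (hm' u hu) (hst.mono fun ω hω _ => hω)

end ConditionalIndependence

section Pareto

variable {V : Type*}

/-- Invariance under multiplication of the argument by positive scalars. An event `E` is scale
invariant when its membership predicate `(· ∈ E)` is. -/
def ScaleInvariant {β : Type*} (f : (V → ℝ) → β) : Prop :=
  ∀ t : ℝ, 0 < t → ∀ x, f (t • x) = f x

theorem ScaleInvariant.mem_preimage {β : Type*} {f : (V → ℝ) → β} (hf : ScaleInvariant f)
    (s : Set β) : ScaleInvariant (· ∈ f ⁻¹' s) := fun t ht x =>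
  congrArg (· ∈ s) (hf t ht x)

theorem ScaleInvariant.mem_inter {E E' : Set (V → ℝ)} (hE : ScaleInvariant (· ∈ E))
    (hE' : ScaleInvariant (· ∈ E')) : ScaleInvariant (· ∈ E ∩ E') := fun t ht x =>
  congrArg₂ And (hE t ht x) (hE' t ht x)

/-- The increment `log x_i - log x_j`, written as the logarithm of a quotient: this form is scale
invariant at every `x`, whereas the difference is so only at points with positive coordinates. -/
noncomputable def logRatio (i j : V) (x : V → ℝ) : ℝ := Real.log (x i / x j)

theorem measurable_logRatio (i j : V) : Measurable (logRatio i j) :=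
  Real.measurable_log.comp ((measurable_pi_apply i).div (measurable_pi_apply j))

theorem scaleInvariant_logRatio (i j : V) : ScaleInvariant (logRatio i j) := fun t ht x => by
  simp only [logRatio, Pi.smul_apply, smul_eq_mul, mul_div_mul_left _ _ ht.ne']

theorem logRatio_eq_sub {x : V → ℝ} {i j : V} (hi : 0 < x i) (hj : 0 < x j) :
    logRatio i j x = Real.log (x i) - Real.log (x j) :=
  Real.log_div hi.ne' hj.ne'

theorem measurableSet_lt_eval (a : ℝ) (k : V) : MeasurableSet {x : V → ℝ | a < x k} :=
  measurableSet_lt measurable_const (measurable_pi_apply k)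

variable {μ : Measure (V → ℝ)}

theorem exceedanceLaw_apply (m : V) (s : Set (V → ℝ)) :
    exceedanceLaw μ m s = (μ {x | 1 < x m})⁻¹ * μ ({x | 1 < x m} ∩ s) :=
  cond_apply (measurableSet_lt_eval 1 m) μ s

theorem exceedanceLaw_absolutelyContinuous (m : V) : exceedanceLaw μ m ≪ μ :=
  cond_absolutelyContinuous

theorem logRatio_ae_eq_sub (hpos : ∀ᵐ x ∂μ, ∀ i, 0 < x i) (m i j : V) :
    logRatio i j =ᵐ[exceedanceLaw μ m] fun x => Real.log (x i) - Real.log (x j) :=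
  (exceedanceLaw_absolutelyContinuous m).ae_le <| hpos.mono fun _ hx =>
    logRatio_eq_sub (hx i) (hx j)

theorem variogram_eq_variance_logRatio (hpos : ∀ᵐ x ∂μ, ∀ i, 0 < x i) (m i j : V) :
    variogram μ m i j = variance (logRatio i j) (exceedanceLaw μ m) :=
  (variance_congr (logRatio_ae_eq_sub hpos m i j)).symm

theorem VariogramExists.memLp_logRatio {m : V} (hvario : VariogramExists μ m)
    (hpos : ∀ᵐ x ∂μ, ∀ i, 0 < x i) (i j : V) : MemLp (logRatio i j) 2 (exceedanceLaw μ m) :=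
  (memLp_congr_ae (logRatio_ae_eq_sub hpos m i j)).2 (hvario i j).2

theorem variogram_self (m i : V) : variogram μ m i i = 0 := by
  simp only [variogram, sub_self]
  exact variance_zero _

variable [Fintype V]

theorem exists_one_lt_of_mem_exceedanceSet {x : V → ℝ} (hx : x ∈ exceedanceSet V) :
    ∃ i, 1 < x i := by
  by_contra! h
  refine hx.2.not_ge ((pi_norm_le_iff_of_nonneg zero_le_one).2 fun i => ?_)
  rw [Real.norm_of_nonneg (hx.1 i)]
  exact h i

theorem mem_exceedanceSet_of_one_lt {x : V → ℝ} (hx : 0 ≤ x) {i : V} (hi : 1 < x i) :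
    x ∈ exceedanceSet V :=
  ⟨hx, hi.trans_le ((le_abs_self _).trans (norm_le_pi_norm x i))⟩

namespace IsMultivariatePareto

theorem measure_one_lt_ne_zero (h : IsMultivariatePareto μ) (m : V) : μ {x | 1 < x m} ≠ 0 := by
  intro hm
  have := h.isProbabilityMeasure
  have hle : ∀ᵐ x ∂μ, ∀ i : V, ¬ 1 < x i :=
    ae_all_iff.2 fun i => measure_eq_zero_iff_ae_notMem.1 (h.margins i m ▸ hm)
  obtain ⟨x, hx, hx'⟩ := (hle.and h.ae_mem).exists
  exact (exists_one_lt_of_mem_exceedanceSet hx').elim hx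

theorem isProbabilityMeasure_exceedanceLaw (h : IsMultivariatePareto μ) (m : V) :
    IsProbabilityMeasure (exceedanceLaw μ m) := by
  have := h.isProbabilityMeasure
  exact cond_isProbabilityMeasure (h.measure_one_lt_ne_zero m)

theorem ae_of_forall_exceedanceLaw (h : IsMultivariatePareto μ) {p : (V → ℝ) → Prop}
    (hp : ∀ m, ∀ᵐ x ∂(exceedanceLaw μ m), p x) : ∀ᵐ x ∂μ, p x := by
  have := h.isProbabilityMeasure
  have hp' : ∀ᵐ x ∂μ, ∀ m : V, 1 < x m → p x := ae_all_iff.2 fun m =>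
    (ae_restrict_iff' (measurableSet_lt_eval 1 m)).1 <|
      (Measure.ae_ennreal_smul_measure_iff (ENNReal.inv_ne_zero.2 (measure_ne_top _ _))).1 (hp m)
  filter_upwards [hp', h.ae_mem] with x hx hx'
  exact (exists_one_lt_of_mem_exceedanceSet hx').elim hx

theorem measure_preimage_inv_smul (h : IsMultivariatePareto μ) {t : ℝ} (ht : 1 ≤ t)
    {D : Set (V → ℝ)} (hD : MeasurableSet D) (hD_lt : ∀ x ∈ D, ∃ k, 1 < x k) :
    μ ((t⁻¹ • ·) ⁻¹' D) = ENNReal.ofReal t⁻¹ * μ D := by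
  have ht₀ : 0 < t := zero_lt_one.trans_le ht
  have hnonneg : ∀ᵐ x ∂μ, x ∈ Set.Ici (0 : V → ℝ) := h.ae_mem.mono fun _ hx => hx.1
  have hhom := h.homogeneous t ht (Set.Ici 0 ∩ D) (measurableSet_Ici.inter hD)
    fun x hx => (hD_lt x hx.2).elim fun _ hk => mem_exceedanceSet_of_one_lt hx.1 hk
  rw [Measure.measure_inter_eq_of_ae hnonneg, ← Set.preimage_smul_inv₀ ht₀.ne',
    Set.preimage_inter] at hhom
  rw [← hhom]
  exact (Measure.measure_inter_eq_of_ae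
    (hnonneg.mono fun x (hx : 0 ≤ x) => smul_nonneg (inv_nonneg.2 ht₀.le) hx)).symm

theorem measure_inter_preimage_inv_smul (h : IsMultivariatePareto μ) {t : ℝ} (ht : 1 ≤ t)
    {E D : Set (V → ℝ)} (hE : MeasurableSet E) (hE_inv : ScaleInvariant (· ∈ E))
    (hD : MeasurableSet D) (hD_lt : ∀ x ∈ D, ∃ k, 1 < x k) :
    μ (E ∩ (t⁻¹ • ·) ⁻¹' D) = ENNReal.ofReal t⁻¹ * μ (E ∩ D) := by
  rw [← h.measure_preimage_inv_smul ht (hE.inter hD) fun x hx => hD_lt x hx.2]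
  congr 1
  ext x
  exact and_congr_left' (hE_inv t⁻¹ (inv_pos.2 (zero_lt_one.trans_le ht)) x).symm.to_iff

theorem measure_inter_lt_eval (h : IsMultivariatePareto μ) {t : ℝ} (ht : 1 ≤ t)
    {E : Set (V → ℝ)} (hE : MeasurableSet E) (hE_inv : ScaleInvariant (· ∈ E)) (k : V) :
    μ (E ∩ {x | t < x k}) = ENNReal.ofReal t⁻¹ * μ (E ∩ {x | 1 < x k}) := by
  rw [← h.measure_inter_preimage_inv_smul ht hE hE_inv (measurableSet_lt_eval 1 k)
    fun x hx => ⟨k, hx⟩]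
  simp only [Set.preimage_ofPred_eq, Pi.smul_apply, smul_eq_mul,
    lt_inv_mul_iff₀ (zero_lt_one.trans_le ht), mul_one]

theorem exceedanceLaw_inter_lt_eval (h : IsMultivariatePareto μ) {E : Set (V → ℝ)}
    (hE : MeasurableSet E) (hE_inv : ScaleInvariant (· ∈ E)) (k : V) (a : ℝ) :
    exceedanceLaw μ k (E ∩ {x | a < x k}) =
      ENNReal.ofReal (max a 1)⁻¹ * exceedanceLaw μ k E := by
  have hmax : {x : V → ℝ | 1 < x k} ∩ (E ∩ {x | a < x k}) = E ∩ {x | max a 1 < x k} := by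
    ext x
    simp only [Set.mem_inter_iff, Set.mem_ofPred_eq, max_lt_iff]
    tauto
  rw [exceedanceLaw_apply, exceedanceLaw_apply, hmax,
    h.measure_inter_lt_eval (le_max_right a 1) hE hE_inv k, Set.inter_comm, mul_left_comm]

theorem indepFun_eval_of_scaleInvariant (h : IsMultivariatePareto μ) {β : Type*}
    [MeasurableSpace β] {f : (V → ℝ) → β} (hf : Measurable f) (hf_inv : ScaleInvariant f)
    (k : V) : IndepFun f (fun x => x k) (exceedanceLaw μ k) := by
  have := h.isProbabilityMeasure_exceedanceLaw k
  rw [IndepFun_iff_Indep]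
  refine IndepSets.indep hf.comap_le (measurable_pi_apply k).comap_le
    (p2 := Set.preimage (fun x => x k) '' Set.range Set.Ioi)
    (@MeasurableSpace.isPiSystem_measurableSet _ (.comap f inferInstance))
    (isPiSystem_Ioi.comap _)
    (@MeasurableSpace.generateFrom_measurableSet _ (.comap f inferInstance)).symm ?_ ?_
  · rw [← MeasurableSpace.comap_generateFrom, ← borel_eq_generateFrom_Ioi ℝ,
      BorelSpace.measurable_eq (α := ℝ)]
  · rw [IndepSets_iff]
    rintro _ _ ⟨F, hF, rfl⟩ ⟨_, ⟨a, rfl⟩, rfl⟩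
    have hlaw := h.exceedanceLaw_inter_lt_eval .univ (fun _ _ _ => rfl) k a
    rw [Set.univ_inter, measure_univ, mul_one] at hlaw
    have hprod := h.exceedanceLaw_inter_lt_eval (hf hF) (hf_inv.mem_preimage F) k a
    rwa [← hlaw, mul_comm] at hprod

theorem measure_inter_lt_eval_inter_lt_eval (h : IsMultivariatePareto μ) {E : Set (V → ℝ)}
    (hE : MeasurableSet E) (hE_inv : ScaleInvariant (· ∈ E)) (m k : V) {t : ℝ} (ht : 1 ≤ t) :
    μ (E ∩ ({x | 1 < x m} ∩ {x | t⁻¹ < x k})) =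
      ENNReal.ofReal t * μ ({x | 1 < x k} ∩ (E ∩ {x | t < x m})) := by
  have ht₀ : 0 < t := zero_lt_one.trans_le ht
  have hpre : (t⁻¹ • ·) ⁻¹' ({x : V → ℝ | 1 < x m} ∩ {x | t⁻¹ < x k}) =
      {x | t < x m} ∩ {x | 1 < x k} := by
    ext x
    simp only [Set.preimage_inter, Set.preimage_ofPred_eq, Pi.smul_apply, smul_eq_mul,
      Set.mem_inter_iff, Set.mem_ofPred_eq, lt_mul_iff_one_lt_right (inv_pos.2 ht₀),
      lt_inv_mul_iff₀ ht₀, mul_one]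
  have hhom := h.measure_inter_preimage_inv_smul ht hE hE_inv
    ((measurableSet_lt_eval 1 m).inter (measurableSet_lt_eval t⁻¹ k)) fun x hx => ⟨m, hx.1⟩
  rw [hpre] at hhom
  rw [Set.inter_comm {x : V → ℝ | 1 < x k}, Set.inter_assoc, hhom, ← mul_assoc,
    ← ENNReal.ofReal_mul ht₀.le, mul_inv_cancel₀ ht₀.ne', ENNReal.ofReal_one, one_mul]

/-- Homogeneity turns the event `Y_m > 1, Y_k > t⁻¹` into `Y_m > t, Y_k > 1`, which is visible from
the root `k`; now let `t = n + 1` tend to infinity. -/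
theorem exceedanceLaw_eq_iSup (h : IsMultivariatePareto μ) {E : Set (V → ℝ)}
    (hE : MeasurableSet E) (hE_inv : ScaleInvariant (· ∈ E)) (m : V) {k : V}
    (hk : ∀ᵐ x ∂μ, 0 < x k) :
    exceedanceLaw μ m E =
      ⨆ n : ℕ, ENNReal.ofReal (n + 1) * exceedanceLaw μ k (E ∩ {x | (n : ℝ) + 1 < x m}) := by
  have hmono : Monotone fun n : ℕ =>
      E ∩ ({x : V → ℝ | 1 < x m} ∩ {x | ((n : ℝ) + 1)⁻¹ < x k}) := fun a b hab =>
    Set.inter_subset_inter_right _ <| Set.inter_subset_inter_right _ fun x hx =>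
      lt_of_le_of_lt (by gcongr) (Set.mem_ofPred_eq ▸ hx)
  have hiUnion : μ ({x | 1 < x m} ∩ E) =
      μ (⋃ n : ℕ, E ∩ ({x | 1 < x m} ∩ {x | ((n : ℝ) + 1)⁻¹ < x k})) := by
    rw [← Set.inter_iUnion, ← Set.inter_iUnion, ← Set.inter_assoc, Set.inter_comm (E ∩ _),
      Set.inter_comm E]
    refine (Measure.measure_inter_eq_of_ae (hk.mono fun x hx => ?_)).symm
    obtain ⟨n, hn⟩ := exists_nat_one_div_lt hx
    exact Set.mem_iUnion.2 ⟨n, by simpa using hn⟩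
  rw [exceedanceLaw_apply, hiUnion, hmono.measure_iUnion, ENNReal.mul_iSup]
  refine iSup_congr fun n => ?_
  rw [h.measure_inter_lt_eval_inter_lt_eval hE hE_inv m k (by simp), exceedanceLaw_apply,
    h.margins m k, mul_left_comm]

theorem exceedanceLaw_inter_eq_mul (h : IsMultivariatePareto μ) {k : V}
    (hk : ∀ᵐ x ∂μ, 0 < x k) {E E' : Set (V → ℝ)} (hE : MeasurableSet E)
    (hE' : MeasurableSet E') (hE_inv : ScaleInvariant (· ∈ E)) (hE'_inv : ScaleInvariant (· ∈ E'))
    {m : V} (hprod : ∀ t : ℝ, exceedanceLaw μ k (E ∩ (E' ∩ {x | t < x m})) =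
      exceedanceLaw μ k E * exceedanceLaw μ k (E' ∩ {x | t < x m})) :
    exceedanceLaw μ m (E ∩ E') = exceedanceLaw μ k E * exceedanceLaw μ m E' := by
  rw [h.exceedanceLaw_eq_iSup (hE.inter hE') (hE_inv.mem_inter hE'_inv) m hk,
    h.exceedanceLaw_eq_iSup hE' hE'_inv m hk, ENNReal.mul_iSup]
  refine iSup_congr fun n => ?_
  rw [Set.inter_assoc, hprod, mul_left_comm]

theorem measure_eq_zero_of_exceedanceLaw_eq_zero (h : IsMultivariatePareto μ) {k : V}
    (hk : ∀ᵐ x ∂μ, 0 < x k) {E : Set (V → ℝ)} (hE : MeasurableSet E)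
    (hE_inv : ScaleInvariant (· ∈ E)) (hE_null : exceedanceLaw μ k E = 0) : μ E = 0 := by
  refine measure_eq_zero_iff_ae_notMem.2 (h.ae_of_forall_exceedanceLaw fun m => ?_)
  rw [← measure_eq_zero_iff_ae_notMem, h.exceedanceLaw_eq_iSup hE hE_inv m hk]
  simp only [measure_mono_null Set.inter_subset_left hE_null, mul_zero, iSup_const]

theorem le_one_of_ae_eq_mul (h : IsMultivariatePareto μ) {i j : V} {a : ℝ}
    (ha : ∀ᵐ x ∂μ, x i = a * x j) : a ≤ 1 := by
  by_contra! ha₁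
  have := h.isProbabilityMeasure
  have ha₀ : 0 < a := zero_lt_one.trans ha₁
  have hij : μ {x | 1 < x j} = μ {x | a < x i} := by
    refine measure_congr ?_
    filter_upwards [ha] with x hx
    exact propext (show 1 < x j ↔ a < x i by rw [hx, lt_mul_iff_one_lt_right ha₀])
  have hscale := h.measure_inter_lt_eval ha₁.le .univ (fun _ _ _ => rfl) i
  rw [Set.univ_inter, Set.univ_inter, ← hij, h.margins i j] at hscale
  have ha_inv := (ENNReal.mul_eq_right (h.measure_one_lt_ne_zero j) (by finiteness)).1 hscale.symm
  exact ha₁.ne' (inv_eq_one.1 (ENNReal.ofReal_eq_one.1 ha_inv))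

theorem ae_eq_of_ae_logRatio_eq (h : IsMultivariatePareto μ) (hpos : ∀ᵐ x ∂μ, ∀ i, 0 < x i)
    {i j : V} {c : ℝ} (hc : ∀ᵐ x ∂μ, logRatio i j x = c) : ∀ᵐ x ∂μ, x i = x j := by
  have hi : ∀ᵐ x ∂μ, x i = Real.exp c * x j := by
    filter_upwards [hpos, hc] with x hx hxc
    rw [← hxc, logRatio, Real.exp_log (div_pos (hx i) (hx j)), div_mul_cancel₀ _ (hx j).ne']
  have hj : ∀ᵐ x ∂μ, x j = (Real.exp c)⁻¹ * x i := hi.mono fun x hx => by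
    rw [hx, inv_mul_cancel_left₀ (Real.exp_pos c).ne']
  have hc₁ : Real.exp c = 1 := (h.le_one_of_ae_eq_mul hi).antisymm
    ((inv_le_one₀ (Real.exp_pos c)).1 (h.le_one_of_ae_eq_mul hj))
  simpa only [hc₁, one_mul] using hi

end IsMultivariatePareto

theorem variogram_pos {m : V} (h : IsMultivariatePareto μ) (hpos : ∀ᵐ x ∂μ, ∀ i, 0 < x i)
    (hvario : VariogramExists μ m) {i j : V} (hij : ¬ ∀ᵐ x ∂μ, x i = x j) :
    0 < variogram μ m i j := by
  have := h.isProbabilityMeasure_exceedanceLaw m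
  contrapose! hij
  have hvar : variance (logRatio i j) (exceedanceLaw μ m) = 0 :=
    (variogram_eq_variance_logRatio hpos m i j ▸ hij).antisymm (variance_nonneg _ _)
  have hconst := ae_eq_integral_of_variance_eq_zero (hvario.memLp_logRatio hpos i j) hvar
  exact h.ae_eq_of_ae_logRatio_eq hpos <| ae_iff.2 <|
    h.measure_eq_zero_of_exceedanceLaw_eq_zero (hpos.mono fun _ hx => hx m)
      ((measurable_logRatio i j (measurableSet_singleton _)).compl)
      ((scaleInvariant_logRatio i j).mem_preimage {_}ᶜ) (ae_iff.1 hconst)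

end Pareto

section MinimumSpanningTree

open SimpleGraph

variable {V : Type*} {T T' G : SimpleGraph V} {ρ : Sym2 V → ℝ}

theorem exists_adj_not_adj_of_ne (hT : T.IsTree) (hT' : T'.IsTree) (hne : T' ≠ T) :
    ∃ u v, T'.Adj u v ∧ ¬ T.Adj u v := by
  contrapose! hne
  exact le_antisymm hne ((isTree_iff_minimal_connected.1 hT).2 hT'.connected hne)

/-- `ρ` is a tree metric on `T`: edges have positive length, and lengths add up along the paths of
`T`. When `T` is a tree, `ρ s(i, j)` is then the length of the path of `T` from `i` to `j`. -/
structure IsTreeMetric (T : SimpleGraph V) (ρ : Sym2 V → ℝ) : Prop where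
  pos : ∀ ⦃i j : V⦄, T.Adj i j → 0 < ρ s(i, j)
  add : ∀ ⦃i j k : V⦄ (p : T.Walk i j), p.IsPath → k ∈ p.support →
    ρ s(i, j) = ρ s(i, k) + ρ s(k, j)

theorem IsTreeMetric.pos_of_isPath (h : IsTreeMetric T ρ) {u v : V} {p : T.Walk u v}
    (hp : p.IsPath) (huv : u ≠ v) : 0 < ρ s(u, v) := by
  induction p with
  | nil => exact absurd rfl huv
  | @cons u k v huk q ih =>
    obtain rfl | hkv := eq_or_ne k v
    · exact h.pos huk
    · rw [h.add (.cons huk q) hp (List.mem_cons_of_mem _ q.start_mem_support)]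
      exact add_pos (h.pos huk) (ih hp.of_cons hkv)

theorem IsTreeMetric.lt_of_mem_edges (h : IsTreeMetric T ρ) {u v : V} {p : T.Walk u v}
    (hp : p.IsPath) {d : Sym2 V} (hd : d ∈ p.edges) (hd_ne : d ≠ s(u, v)) :
    ρ d < ρ s(u, v) := by
  induction p with
  | nil => simp at hd
  | @cons u k v huk q ih =>
    rw [h.add (.cons huk q) hp (List.mem_cons_of_mem _ q.start_mem_support)]
    rw [Walk.edges_cons, List.mem_cons] at hd
    by_cases hd_uk : d = s(u, k)
    · have hkv : k ≠ v := fun hkv => hd_ne (hkv ▸ hd_uk)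
      linarith [h.pos_of_isPath hp.of_cons hkv, congrArg ρ hd_uk]
    · have hd_le : ρ d ≤ ρ s(k, v) := by
        by_cases hd_kv : d = s(k, v)
        · exact (congrArg ρ hd_kv).le
        · exact (ih hp.of_cons (hd.resolve_left hd_uk) hd_kv).le
      linarith [h.pos huk]

variable [Fintype V]

theorem totalWeight_eq_sum_edgeFinset (ρ : Sym2 V → ℝ) (G : SimpleGraph V) [Fintype G.edgeSet] :
    totalWeight ρ G = ∑ e ∈ G.edgeFinset, ρ e := by
  unfold totalWeight
  congr!

theorem totalWeight_sup_edge (ρ : Sym2 V → ℝ) {a b : V} (hG : ¬ G.Adj a b) (hab : a ≠ b) :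
    totalWeight ρ (G ⊔ edge a b) = totalWeight ρ G + ρ s(a, b) := by
  classical
  rw [totalWeight_eq_sum_edgeFinset, edgeFinset_sup_edge G hG hab, Finset.sum_cons, add_comm,
    totalWeight_eq_sum_edgeFinset]

theorem totalWeight_deleteEdges_singleton (ρ : Sym2 V → ℝ) {e : Sym2 V} (he : e ∈ G.edgeSet) :
    totalWeight ρ (G.deleteEdges {e}) = totalWeight ρ G - ρ e := by
  classical
  have hG : (G.deleteEdges {e}).edgeFinset = G.edgeFinset.erase e := by
    ext d
    simp [and_comm]
  rw [totalWeight_eq_sum_edgeFinset, totalWeight_eq_sum_edgeFinset, hG,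
    Finset.sum_erase_eq_sub (mem_edgeFinset.2 he)]

/-- Unit weights count edges, so that the effect of an exchange of edges on the total weight also
yields its effect on the number of edges. -/
theorem totalWeight_one_add_one (hT : T.IsTree) :
    totalWeight (fun _ => 1) T + 1 = Fintype.card V := by
  classical
  rw [totalWeight, Finset.sum_const, nsmul_one, ← hT.card_edgeFinset]
  norm_cast

theorem isTree_of_isAcyclic_of_totalWeight_one [Nonempty V] (hG : G.IsAcyclic)
    (hcard : totalWeight (fun _ => 1) G + 1 = Fintype.card V) : G.IsTree := by
  classical
  obtain ⟨F, hGF, -, hF⟩ := connected_top.exists_isTree_le_of_le_of_isAcyclic le_top hG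
  have hFG : F.edgeFinset.card ≤ G.edgeFinset.card := by
    rw [← totalWeight_one_add_one hF] at hcard
    simpa [totalWeight] using hcard.ge
  rwa [edgeFinset_inj.1 (Finset.eq_of_subset_of_card_le (edgeFinset_mono hGF) hFG)]

/-- The path `p` has to cross between the two components of `T'` without `{u, v}`, and it does so
along `d`. -/
theorem exists_isTree_exchange (hT' : T'.IsTree) {u v : V} (huv : T'.Adj u v)
    (p : T.Walk u v) : ∃ S : SimpleGraph V, S.IsTree ∧ ∃ d ∈ p.edges,
      ∀ ρ, totalWeight ρ S = totalWeight ρ T' - ρ s(u, v) + ρ d := by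
  have := hT'.connected.nonempty
  set F := T'.deleteEdges {s(u, v)}
  have hF : ¬ F.Reachable u v :=
    isBridge_iff.1 (isAcyclic_iff_forall_adj_isBridge.1 hT'.isAcyclic huv)
  obtain ⟨d, hd, hd_fst, hd_snd⟩ := p.exists_boundary_dart {x | F.Reachable u x} .rfl hF
  have hd_not : ¬ F.Reachable d.fst d.snd := fun h => hd_snd (hd_fst.trans h)
  have hweight : ∀ ρ, totalWeight ρ (F ⊔ edge d.fst d.snd) =
      totalWeight ρ T' - ρ s(u, v) + ρ d.edge := fun ρ => by
    rw [totalWeight_sup_edge ρ (fun h => hd_not h.reachable) d.fst_ne_snd,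
      totalWeight_deleteEdges_singleton ρ huv, Dart.edge_mk]
  refine ⟨F ⊔ edge d.fst d.snd, isTree_of_isAcyclic_of_totalWeight_one ?_ ?_, d.edge,
    List.mem_map_of_mem hd, hweight⟩
  · exact (hT'.isAcyclic.anti (deleteEdges_le _)).sup_edge_of_not_reachable hd_not
  · rw [hweight, sub_add_cancel, totalWeight_one_add_one hT']

theorem isMinimumSpanningTree_iff_eq (hT : T.IsTree)
    (hρ : ∀ ⦃u v : V⦄ (p : T.Walk u v), p.IsPath → ∀ d ∈ p.edges, d ≠ s(u, v) →
      ρ d < ρ s(u, v)) :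
    IsMinimumSpanningTree ρ T' ↔ T' = T := by
  have eq_of_isMin : ∀ S, IsMinimumSpanningTree ρ S → S = T := by
    rintro S ⟨hS, hmin⟩
    by_contra hne
    obtain ⟨u, v, huv, huv_not⟩ := exists_adj_not_adj_of_ne hT hS hne
    obtain ⟨p, hp, -⟩ := hT.existsUnique_path u v
    obtain ⟨S', hS', d, hd, hweight⟩ := exists_isTree_exchange hS huv p
    have hd_ne : d ≠ s(u, v) := fun h => huv_not (p.edges_subset_edgeSet (h ▸ hd))
    linarith [hmin S' hS', hweight ρ, hρ p hp d hd hd_ne]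
  obtain ⟨S, hS, hmin⟩ := Set.exists_min_image {S : SimpleGraph V | S.IsTree} (totalWeight ρ)
    (Set.toFinite _) ⟨T, hT⟩
  refine ⟨eq_of_isMin T', fun h => ?_⟩
  rw [h, ← eq_of_isMin S ⟨hS, hmin⟩]
  exact ⟨hS, hmin⟩

theorem IsTreeMetric.isMinimumSpanningTree_iff_eq (hT : T.IsTree) (h : IsTreeMetric T ρ) :
    IsMinimumSpanningTree ρ T' ↔ T' = T :=
  ExtremalTree.isMinimumSpanningTree_iff_eq hT fun _ _ _ hp _ => h.lt_of_mem_edges hp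

end MinimumSpanningTree

section TreeModel

open SimpleGraph

variable {V : Type*}

theorem comap_proj (A : Set V) :
    MeasurableSpace.comap (proj A) inferInstance =
      ⨆ i ∈ A, MeasurableSpace.comap (fun x : V → ℝ => x i) inferInstance := by
  simp only [MeasurableSpace.pi, MeasurableSpace.comap_iSup, MeasurableSpace.comap_comp,
    iSup_subtype']
  rfl

theorem comap_proj_union (A B : Set V) :
    MeasurableSpace.comap (proj (A ∪ B)) inferInstance =
      MeasurableSpace.comap (proj A) inferInstance ⊔
        MeasurableSpace.comap (proj B) inferInstance := by
  rw [comap_proj, comap_proj, comap_proj, iSup_union]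

theorem comap_proj_singleton (k : V) :
    MeasurableSpace.comap (proj {k}) inferInstance =
      MeasurableSpace.comap (fun x : V → ℝ => x k) inferInstance := by
  rw [comap_proj, iSup_singleton]

theorem measurable_eval_comap_proj {A : Set V} {i : V} (hi : i ∈ A) :
    Measurable[MeasurableSpace.comap (proj A) inferInstance] fun x : V → ℝ => x i :=
  (measurable_pi_apply (⟨i, hi⟩ : A)).comp (comap_measurable (proj A))

theorem measurable_logRatio_comap_proj {A : Set V} {i j : V} (hi : i ∈ A) (hj : j ∈ A) :
    Measurable[MeasurableSpace.comap (proj A) inferInstance] (logRatio i j) :=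
  Real.measurable_log.comp
    ((measurable_eval_comap_proj hi).div (measurable_eval_comap_proj hj))

variable {G T : SimpleGraph V} {A A₁ A₂ B C : Set V}

theorem Separates.symm (h : Separates G A C B) : Separates G C A B := fun c hc a ha p hp => by
  simpa only [Walk.support_reverse, List.mem_reverse] using h a ha c hc p.reverse hp.reverse

theorem Separates.union_left (h₁ : Separates G A₁ C B) (h₂ : Separates G A₂ C B) :
    Separates G (A₁ ∪ A₂) C B := fun a ha => ha.elim (h₁ a) (h₂ a)

theorem Separates.singleton_or {i j : V} (h : Separates G {i} {j} B) (m : V) :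
    Separates G {m} {i} B ∨ Separates G {m} {j} B := by
  classical
  by_contra! hm
  simp only [Separates, Set.mem_singleton_iff, forall_eq] at h hm
  push Not at hm
  obtain ⟨⟨p, -, hp⟩, q, -, hq⟩ := hm
  obtain ⟨b, hb, hbB⟩ := h (p.reverse.append q).bypass (p.reverse.append q).bypass_isPath
  have hb_pq := Walk.support_bypass_subset_support _ hb
  rw [Walk.mem_support_append_iff, Walk.support_reverse, List.mem_reverse] at hb_pq
  exact hb_pq.elim (hp b · hbB) (hq b · hbB)

theorem separates_of_mem_support (hT : T.IsAcyclic) {i j k : V} {p : T.Walk i j}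
    (hp : p.IsPath) (hk : k ∈ p.support) : Separates T {i} {j} {k} := by
  rintro _ rfl _ rfl q hq
  have hqp : q = p := congrArg Subtype.val ((hT.subsingleton_path _ _).elim ⟨q, hq⟩ ⟨p, hp⟩)
  exact ⟨k, hqp ▸ hk, rfl⟩

variable [Fintype V] {μ : Measure (V → ℝ)}

theorem IsExtremalGraphicalModel.extremalCondIndep_diff (hmodel : IsExtremalGraphicalModel μ G)
    (hBC : Disjoint B C) (hsep : Separates G A C B) : ExtremalCondIndep μ (A \ B) C B := by
  refine hmodel.globalMarkov (A \ B) B C Set.disjoint_sdiff_left ?_ hBC fun a ha => hsep a ha.1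
  refine Set.disjoint_left.2 fun a ha hc => ?_
  obtain ⟨b, hb, hbB⟩ := hsep a ha.1 a hc .nil .nil
  exact ha.2 (List.mem_singleton.1 hb ▸ hbB)

theorem indep_logRatio_proj (hmodel : IsExtremalGraphicalModel μ G) {j k : V} (hjk : j ≠ k)
    (hsep : Separates G A {j} {k}) :
    Indep (MeasurableSpace.comap (logRatio j k) inferInstance)
      (MeasurableSpace.comap (proj ({k} ∪ A)) inferInstance) (exceedanceLaw μ k) := by
  have h := hmodel.isMultivariatePareto
  have := h.isProbabilityMeasure_exceedanceLaw k
  have hind := h.indepFun_eval_of_scaleInvariant (measurable_logRatio j k)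
    (scaleInvariant_logRatio j k) k
  rw [IndepFun_iff_Indep, ← comap_proj_singleton] at hind
  have hci := (hmodel.extremalCondIndep_diff (Set.disjoint_singleton.2 hjk.symm) hsep k).symm
  have hci_logRatio := condIndep_of_condIndep_of_le_left
    (condIndep_sup_left (measurable_proj {j}).comap_le (measurable_proj (A \ {k})).comap_le hci)
    (comap_proj_union {k} {j} ▸
      (measurable_logRatio_comap_proj (A := {k} ∪ {j}) (.inr rfl) (.inl rfl)).comap_le)
  rw [← Set.union_sdiff_self, comap_proj_union]
  exact indep_sup_of_condIndep (measurable_logRatio j k).comap_le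
    (measurable_proj (A \ {k})).comap_le hind hci_logRatio

section

variable {i j k m : V}

theorem exceedanceLaw_preimage_logRatio_inter (hmodel : IsExtremalGraphicalModel μ G)
    (hpos : ∀ᵐ x ∂μ, 0 < x k) (hjk : j ≠ k) (hi : Separates G {i} {j} {k})
    (hm : Separates G {m} {j} {k}) {F F' : Set ℝ} (hF : MeasurableSet F)
    (hF' : MeasurableSet F') :
    exceedanceLaw μ m (logRatio j k ⁻¹' F ∩ logRatio i k ⁻¹' F') =
      exceedanceLaw μ k (logRatio j k ⁻¹' F) * exceedanceLaw μ m (logRatio i k ⁻¹' F') := by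
  refine hmodel.isMultivariatePareto.exceedanceLaw_inter_eq_mul hpos
    (measurable_logRatio j k hF) (measurable_logRatio i k hF')
    ((scaleInvariant_logRatio j k).mem_preimage F)
    ((scaleInvariant_logRatio i k).mem_preimage F') fun t => ?_
  refine (Indep_iff _ _ _).1 (indep_logRatio_proj hmodel hjk (hi.union_left hm)) _ _ ⟨F, hF, rfl⟩ ?_
  exact (measurable_logRatio_comap_proj (.inr (.inl rfl)) (.inl rfl) hF').inter
    (measurable_eval_comap_proj (.inr (.inr rfl)) measurableSet_Ioi)

theorem indepFun_logRatio_logRatio (hmodel : IsExtremalGraphicalModel μ G)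
    (hpos : ∀ᵐ x ∂μ, 0 < x k) (hjk : j ≠ k) (hi : Separates G {i} {j} {k})
    (hm : Separates G {m} {j} {k}) :
    IndepFun (logRatio j k) (logRatio i k) (exceedanceLaw μ m) := by
  have := hmodel.isMultivariatePareto.isProbabilityMeasure_exceedanceLaw m
  refine indepFun_iff_measure_inter_preimage_eq_mul.2 fun F F' hF hF' => ?_
  have hmarginal : exceedanceLaw μ m (logRatio j k ⁻¹' F) =
      exceedanceLaw μ k (logRatio j k ⁻¹' F) := by
    simpa only [Set.preimage_univ, Set.inter_univ, measure_univ, mul_one] using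
      exceedanceLaw_preimage_logRatio_inter hmodel hpos hjk hi hm hF .univ
  rw [hmarginal, exceedanceLaw_preimage_logRatio_inter hmodel hpos hjk hi hm hF hF']

theorem variogram_add_of_separates_root (hmodel : IsExtremalGraphicalModel μ G)
    (hpos : ∀ᵐ x ∂μ, ∀ i, 0 < x i) (hvario : VariogramExists μ m)
    (hi : Separates G {i} {j} {k}) (hm : Separates G {m} {j} {k}) :
    variogram μ m i j = variogram μ m i k + variogram μ m k j := by
  obtain rfl | hjk := eq_or_ne j k
  · rw [variogram_self, add_zero]
  have := hmodel.isMultivariatePareto.isProbabilityMeasure_exceedanceLaw m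
  have hind := indepFun_logRatio_logRatio hmodel (hpos.mono fun _ hx => hx k) hjk hi hm
  have hik_memLp := hvario.memLp_logRatio hpos i k
  have hjk_memLp := hvario.memLp_logRatio hpos j k
  have hsub : logRatio i j =ᵐ[exceedanceLaw μ m] logRatio i k - logRatio j k := by
    filter_upwards [logRatio_ae_eq_sub hpos m i j, logRatio_ae_eq_sub hpos m i k,
      logRatio_ae_eq_sub hpos m j k] with x hij hik hjk
    rw [Pi.sub_apply, hij, hik, hjk, sub_sub_sub_cancel_right]
  rw [variogram_comm μ m k j, variogram_eq_variance_logRatio hpos,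
    variogram_eq_variance_logRatio hpos, variogram_eq_variance_logRatio hpos,
    variance_congr hsub, variance_sub hik_memLp hjk_memLp,
    hind.symm.covariance_eq_zero hik_memLp hjk_memLp, mul_zero, sub_zero]

theorem variogram_add_of_separates (hmodel : IsExtremalGraphicalModel μ G)
    (hpos : ∀ᵐ x ∂μ, ∀ i, 0 < x i) (hvario : VariogramExists μ m)
    (hsep : Separates G {i} {j} {k}) :
    variogram μ m i j = variogram μ m i k + variogram μ m k j := by
  obtain hm | hm := hsep.singleton_or m
  · rw [variogram_comm μ m i j, variogram_comm μ m i k, variogram_comm μ m k j, add_comm]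
    exact variogram_add_of_separates_root hmodel hpos hvario hsep.symm hm
  · exact variogram_add_of_separates_root hmodel hpos hvario hsep hm

end

theorem isTreeMetric_weightedVariogram (hT : T.IsAcyclic) (hmodel : IsExtremalGraphicalModel μ T)
    (hpos : ∀ᵐ x ∂μ, ∀ i, 0 < x i) {w : V → ℝ} (hw : ∀ m, 0 ≤ w m) (hw_pos : ∃ m, 0 < w m)
    (hvario : ∀ m, 0 < w m → VariogramExists μ m)
    (hne : ∀ i j, T.Adj i j → ¬ ∀ᵐ x ∂μ, x i = x j) :
    IsTreeMetric T (weightedVariogram μ w) where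
  pos i j hij := by
    have hterm : ∀ m, 0 < w m → 0 < w m * variogram μ m i j := fun m hm => mul_pos hm <|
      variogram_pos hmodel.isMultivariatePareto hpos (hvario m hm) (hne i j hij)
    obtain ⟨m, hm⟩ := hw_pos
    exact Finset.sum_pos' (fun n _ => mul_nonneg (hw n) (variance_nonneg _ _))
      ⟨m, Finset.mem_univ m, hterm m hm⟩
  add i j k p hp hk := by
    simp only [weightedVariogram, Sym2.lift_mk, ← Finset.sum_add_distrib, ← mul_add]
    refine Finset.sum_congr rfl fun m _ => ?_
    obtain hm | hm := (hw m).eq_or_lt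
    · rw [← hm, zero_mul, zero_mul]
    · rw [variogram_add_of_separates hmodel hpos (hvario m hm)
        (separates_of_mem_support hT hp hk)]

end TreeModel

theorem mainTheorem7_general {V : Type*} [Fintype V] {μ : Measure (V → ℝ)} {T : SimpleGraph V}
    (hT : T.IsTree) (hmodel : IsExtremalGraphicalModel μ T) (hpos : ∀ᵐ x ∂μ, ∀ i, 0 < x i)
    {w : V → ℝ} (hw : ∀ m, 0 ≤ w m) (hw_pos : ∃ m, 0 < w m)
    (hvario : ∀ m, 0 < w m → VariogramExists μ m)
    (hne : ∀ i j, T.Adj i j → ¬ ∀ᵐ x ∂μ, x i = x j) (T' : SimpleGraph V) :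
    IsMinimumSpanningTree (weightedVariogram μ w) T' ↔ T' = T :=
  (isTreeMetric_weightedVariogram hT.isAcyclic hmodel hpos hw hw_pos hvario
    hne).isMinimumSpanningTree_iff_eq hT

end ExtremalTree

theorem mainTheorem7 {V : Type*} [Fintype V] {Ω : Type*} [MeasurableSpace Ω]
    (P : Measure Ω) [IsProbabilityMeasure P] (Y : Ω → V → ℝ) (hY : AEMeasurable Y P)
    (T : SimpleGraph V) (hT : T.IsTree)
    (hmodel : ExtremalTree.IsExtremalGraphicalModel (P.map Y) T)
    (hvario : ∀ m : V, ExtremalTree.VariogramExists (P.map Y) m)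
    (hne : ∀ i j : V, i ≠ j → 0 < P {ω | Y ω i ≠ Y ω j})
    (w : V → ℝ) (hw : ∀ m, 0 ≤ w m) (hw_pos : ∃ m, 0 < w m) :
    ∀ T' : SimpleGraph V,
      ExtremalTree.IsMinimumSpanningTree (ExtremalTree.weightedVariogram (P.map Y) w) T' ↔
        T' = T :=
  ExtremalTree.mainTheorem7_general hT hmodel
    (hmodel.isMultivariatePareto.ae_of_forall_exceedanceLaw fun m =>
      ae_all_iff.2 fun i => (hvario m i i).1.mono fun _ hx => hx.1)
    hw hw_pos (fun m _ => hvario m)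
    fun i j hij h => (hne i j hij.ne).ne' (ae_iff.1 (ae_of_ae_map hY h))
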